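/- Let $X$ be a directed graph, and for vertices $x,y$ let $d(x,y)\in\mathbb{N}\cup\{\infty\}$ be the length of a shortest directed path from $x$ to $y$ ($\infty$ if there is none). A directed path $[x_0,\dots,x_n]$ is a geodesic if $n=d(x_0,x_n)$. A geodesic triangle is a triple $(p,q,r)$ of geodesics such that $p$ ends where $q$ starts, $r$ starts where $p$ starts, and $r$ ends where $q$ ends. For a real number $\delta\ge 0$ the triangle is $\delta$-thin if each side $s$ has the following property: every vertex $v$ of $s$ satisfies $d(u,v)\le\delta$ for some vertex $u$ of the side meeting $s$ at its start, or $d(v,w)\le\delta$ for some vertex $w$ of the side meeting $s$ at its end. Explicitly, every vertex of $r$ is within $\delta$ from some vertex of $p$ or within $\delta$ to some vertex of $q$; every vertex of $p$ is within $\delta$ from some vertex of $r$ or within $\delta$ to some vertex of $q$; and every vertex of $q$ is within $\delta$ from some vertex of $p$ or within $\delta$ to some vertex of $r$. The directed graph $X$ is strongly $\delta$-hyperbolic if all its geodesic triangles are $\delta$-thin. A monoid $M$ is strongly hyperbolic if, for some finite set $S$ generating $M$ as a monoid and some $\delta\ge 0$, its right Cayley graph with respect to $S$ (vertex set $M$,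 edges $m\to ms$ for $m\in M$, $s\in S$) is strongly $\delta$-hyperbolic. A group $G$ is (word) hyperbolic if, for some finite set $A$ generating $G$ as a group and some $\delta\ge 0$, its undirected Cayley graph with respect to $A$ is $\delta$-hyperbolic in the usual sense: in every geodesic triangle (with vertices of the graph as corners), every vertex on one side is within distance $\delta$ of a vertex on one of the other two sides. **Theorem.** Let $M$ be a (two-sided) cancellative monoid that is strongly hyperbolic. Then the group of units of $M$ is a (word) hyperbolic group. -/

import Mathlib

open scoped NNReal ENNReal

/-! ### Directed graphs and thin triangles -/

namespace Digraph

variable {V : Type*} (X : Digraph V)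

/-- The edge set of a directed graph, as a binary relation. -/
def edgeRel : SetRel V V := {e | X.Adj e.1 e.2}

/-- A path of length `n` in a directed graph: a sequence `[x₀, …, xₙ]` of vertices
such that there is an edge from each `xᵢ` to `xᵢ₊₁`. -/
abbrev Path := RelSeries X.edgeRel

/-- The length of a shortest directed path from `x` to `y`, or `∞` if there is none. -/
noncomputable def edist (x y : V) : ℕ∞ :=
  ⨅ (p : X.Path) (_ : p.head = x ∧ p.last = y), (p.length : ℕ∞)

variable {X}

/-- A path is geodesic if its length is the distance from its start to its end. -/
def Path.IsGeodesic (p : X.Path) : Prop :=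
  (p.length : ℕ∞) = X.edist p.head p.last

variable (X)

/-- The out-ball of radius `δ` based at `x`. -/
def outBall (δ : ℝ≥0) (x : V) : Set V := {y | (X.edist x y : ℝ≥0∞) ≤ δ}

/-- The in-ball of radius `δ` based at `x`. -/
def inBall (δ : ℝ≥0) (x : V) : Set V := {y | (X.edist y x : ℝ≥0∞) ≤ δ}

/-- The union of the out-balls of radius `δ` around the points of `S`. -/
def outNhd (δ : ℝ≥0) (S : Set V) : Set V := ⋃ x ∈ S, X.outBall δ x

/-- The union of the in-balls of radius `δ` around the points of `S`. -/
def inNhd (δ : ℝ≥0) (S : Set V) : Set V := ⋃ x ∈ S, X.inBall δ x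

variable {X}

/-- The set of vertices visited by a path. -/
def Path.support (p : X.Path) : Set V := {x | x ∈ p}

/-- A geodesic triangle: `p`, `q`, `r` are geodesics, `p` and `q` are composable, and
the composite of `p` and `q` is parallel to `r`. -/
structure IsGeodesicTriangle (p q r : X.Path) : Prop where
  geodesic_left : Path.IsGeodesic p
  geodesic_right : Path.IsGeodesic q
  geodesic_base : Path.IsGeodesic r
  composable : p.last = q.head
  start_eq : p.head = r.head
  end_eq : q.last = r.last

/-- A triangle `(p, q, r)` is `δ`-thin if each side is contained in the union of the out-balls of
radius `δ` around points on the side meeting its start, and the in-balls of radius `δ`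
around points on the side meeting its end. -/
def IsThin (δ : ℝ≥0) (p q r : X.Path) : Prop :=
  Path.support r ⊆ X.outNhd δ (Path.support p) ∪ X.inNhd δ (Path.support q) ∧
  Path.support p ⊆ X.outNhd δ (Path.support r) ∪ X.inNhd δ (Path.support q) ∧
  Path.support q ⊆ X.outNhd δ (Path.support p) ∪ X.inNhd δ (Path.support r)

variable (X)

/-- A directed graph is strongly `δ`-hyperbolic if all of its geodesic triangles are `δ`-thin. -/
def StronglyHyperbolic (δ : ℝ≥0) : Prop :=
  ∀ p q r : X.Path, IsGeodesicTriangle p q r → IsThin δ p q r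

/-- The right Cayley graph of a monoid: an edge from `m` to `m * s` for each `s ∈ S`. -/
def rightCayley {M : Type*} [Monoid M] (S : Set M) : Digraph M where
  Adj m n := ∃ s ∈ S, m * s = n

end Digraph

/-- A monoid is strongly hyperbolic if, for some finite monoid generating set `S` and some `δ`,
its right Cayley graph with respect to `S` is strongly `δ`-hyperbolic. -/
def IsStronglyHyperbolicMonoid (M : Type*) [Monoid M] : Prop :=
  ∃ S : Set M, S.Finite ∧ Submonoid.closure S = ⊤ ∧
    ∃ δ : ℝ≥0, (Digraph.rightCayley S).StronglyHyperbolic δ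

/-! ### Hyperbolic groups in the classical sense -/

/-- An undirected graph is `δ`-hyperbolic if its geodesic triangles are `δ`-slim: for all geodesics
`p`, `q`, `r` joining the three pairs of vertices from `x`, `y`, `z`, every vertex of `p` is within
distance `δ` of a vertex of `q` or of `r`. (As the names of the corners are arbitrary, this says
the same of every side of every geodesic triangle.) -/
def SimpleGraph.IsSlimHyperbolic {V : Type*} (G : SimpleGraph V) (δ : ℝ≥0) : Prop :=
  ∀ (x y z : V) (p : G.Walk x y) (q : G.Walk y z) (r : G.Walk x z),
    p.length = G.dist x y → q.length = G.dist y z → r.length = G.dist x z →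
      ∀ u ∈ p.support, ∃ v, (v ∈ q.support ∨ v ∈ r.support) ∧ (G.dist u v : ℝ) ≤ δ

/-- A group is (word) hyperbolic if it has a finite generating set `A` such that its undirected
Cayley graph with respect to `A` is `δ`-hyperbolic for some `δ`. -/
def IsHyperbolicGroup (G : Type*) [Group G] : Prop :=
  ∃ A : Set G, A.Finite ∧ Subgroup.closure A = ⊤ ∧
    ∃ δ : ℝ≥0, (SimpleGraph.mulCayley A).IsSlimHyperbolic δ

/-!
An edge of the right Cayley graph of `M` that ends at a unit starts at a unit and is labelled by a
unit. Hence the Cayley graph of `Mˣ` with respect to the generators that are units is isometrically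
embedded, and `Mˣ` is a strongly hyperbolic monoid.

In a group with finitely many generators, edges can be reversed at bounded cost, so the directed
distance is bi-Lipschitz to the undirected one. Thinness of directed triangles gives, by repeated
subdivision, that a directed geodesic is logarithmically close to every undirected path with the
same ends. As in the Morse lemma, this improves to a uniform bound if the path is an undirected
geodesic, and then the undirected geodesic is also uniformly close to the directed one. Thus
thinness passes from directed to undirected geodesic triangles.
-/

theorem exists_bound_of_le_add_mul_clog (a b C : ℕ) :
    ∃ R, ∀ D, D ≤ a + b * Nat.clog 2 (C * D) → D ≤ R := by
  have hlim : Filter.Tendsto (fun k : ℕ ↦ ((C * (a + b) * 2 : ℕ) : ℝ) * ((k : ℝ) ^ 1 / 2 ^ k))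
      Filter.atTop (nhds 0) := by
    simpa only [mul_zero] using
      (tendsto_pow_const_div_const_pow_of_one_lt 1 one_lt_two).const_mul _
  obtain ⟨N, hN⟩ := Filter.eventually_atTop.1 (hlim.eventually (gt_mem_nhds one_pos))
  refine ⟨a + b * (N + 1), fun D hD ↦ hD.trans ?_⟩
  gcongr
  by_contra! hlt
  obtain ⟨k, hk⟩ : ∃ k, Nat.clog 2 (C * D) = k + 1 := ⟨_, (Nat.sub_add_cancel (by lia)).symm⟩
  have hpow : C * (a + b) * 2 * k < 2 ^ k := by
    have := hN k (by lia)
    rw [pow_one, ← mul_div_assoc, div_lt_one (by positivity)] at this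
    exact_mod_cast this
  refine (hpow.trans (Nat.pow_lt_of_lt_clog (by lia : k < Nat.clog 2 (C * D)))).not_ge ?_
  calc C * D ≤ C * (a + b * (k + 1)) := by gcongr; rwa [← hk]
    _ ≤ C * (a * (2 * k) + b * (2 * k)) := by
      gcongr
      · exact Nat.le_mul_of_pos_right _ (by lia)
      · lia
    _ = C * (a + b) * 2 * k := by ring

section MetricInterval

variable {V : Type*} {d : V → V → ℕ} {v w x y : V}

/-- The interval from `x` to `y` for a possibly asymmetric distance `d`: the points `w` at which
the triangle inequality is an equality. If `d` is the distance of a graph, these are the vertices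
of all the geodesics from `x` to `y`. -/
def metricInterval (d : V → V → ℕ) (x y : V) : Set V := {w | d x w + d w y = d x y}

theorem metricInterval_subset_of_mem_left (htri : ∀ a b c, d a c ≤ d a b + d b c)
    (hw : w ∈ metricInterval d x y) : metricInterval d x w ⊆ metricInterval d x y := by
  intro v (hv : d x v + d v w = d x w)
  have hw' : d x w + d w y = d x y := hw
  have := htri x v y
  have := htri v w y
  change d x v + d v y = d x y
  lia

theorem metricInterval_subset_of_mem_right (htri : ∀ a b c, d a c ≤ d a b + d b c)
    (hw : w ∈ metricInterval d x y) : metricInterval d w y ⊆ metricInterval d x y := by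
  intro v (hv : d w v + d v y = d w y)
  have hw' : d x w + d w y = d x y := hw
  have := htri x v y
  have := htri x w v
  change d x v + d v y = d x y
  lia

theorem mem_metricInterval_of_mem_of_mem (htri : ∀ a b c, d a c ≤ d a b + d b c)
    (hw : w ∈ metricInterval d x y) (hv : v ∈ metricInterval d x w) :
    w ∈ metricInterval d v y := by
  have hw' : d x w + d w y = d x y := hw
  have hv' : d x v + d v w = d x w := hv
  have := htri x v y
  have := htri v w y
  change d v w + d w y = d v y
  lia

end MetricInterval

section GeodesicWalk

open SimpleGraph

variable {V : Type*} {G : SimpleGraph V} {u v w x y : V} {p : G.Walk x y}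

theorem mem_metricInterval_dist_of_mem_support (hp : p.length = G.dist x y) (hw : w ∈ p.support) :
    w ∈ metricInterval G.dist x y := by
  classical
  change G.dist x w + G.dist w y = G.dist x y
  rw [← length_eq_dist_of_subwalk hp (p.isSubwalk_takeUntil hw),
    ← length_eq_dist_of_subwalk hp (p.isSubwalk_dropUntil hw), ← hp, ← Walk.length_append,
    p.take_spec hw]

theorem exists_walk_length_eq_dist_of_mem_support (hp : p.length = G.dist x y)
    (hu : u ∈ p.support) (hv : v ∈ p.support) :
    ∃ q : G.Walk u v, q.length = G.dist u v ∧ q.support ⊆ p.support := by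
  classical
  rw [← p.take_spec hu, Walk.mem_support_append_iff] at hv
  rcases hv with hv | hv
  · have hsub := ((p.takeUntil u hu).isSubwalk_dropUntil hv).trans (p.isSubwalk_takeUntil hu)
    refine ⟨((p.takeUntil u hu).dropUntil v hv).reverse, ?_, ?_⟩
    · rw [Walk.length_reverse, length_eq_dist_of_subwalk hp hsub, dist_comm]
    · rw [Walk.support_reverse, List.reverse_subset]
      exact hsub.support_subset
  · have hsub := ((p.dropUntil u hu).isSubwalk_takeUntil hv).trans (p.isSubwalk_dropUntil hu)
    exact ⟨_, length_eq_dist_of_subwalk hp hsub, hsub.support_subset⟩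

theorem dist_add_dist_of_mem_support_append (hG : G.Connected) {p : G.Walk x w} {q : G.Walk w y}
    (hpq : (p.append q).length = G.dist x y) (hu : u ∈ p.support) (hv : v ∈ q.support) :
    G.dist u w + G.dist w v = G.dist u v := by
  have hw : G.dist x w + G.dist w y = G.dist x y :=
    mem_metricInterval_dist_of_mem_support hpq
      ((Walk.mem_support_append_iff _ _).2 (.inl p.end_mem_support))
  have hp : p.length = G.dist x w :=
    length_eq_dist_of_subwalk hpq (Walk.isSubwalk_of_append_left rfl)
  have hq : q.length = G.dist w y :=
    length_eq_dist_of_subwalk hpq (Walk.isSubwalk_of_append_right rfl)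
  have hu' : G.dist x u + G.dist u w = G.dist x w := mem_metricInterval_dist_of_mem_support hp hu
  have hv' : G.dist w v + G.dist v y = G.dist w y := mem_metricInterval_dist_of_mem_support hq hv
  have := hG.dist_triangle (u := x) (v := u) (w := y)
  have := hG.dist_triangle (u := u) (v := v) (w := y)
  have := hG.dist_triangle (u := u) (v := w) (w := v)
  lia

end GeodesicWalk

/-! ### Thin directed distances and the Morse lemma -/

/-- A directed distance `d` on the vertices of a connected graph `G` which is a quasi-metric whose
points can be joined by discrete geodesics, is bi-Lipschitz to the distance of `G` with constant
`K`, and has `h`-thin triangles. Thinness is only required of the side from `x` to `z` of a triangle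
`x`, `y`, `z`, and is phrased with intervals rather than with geodesics. -/
structure IsThinDirectedDist {V : Type*} (G : SimpleGraph V) (d : V → V → ℕ) (K h : ℕ) :
    Prop where
  connected : G.Connected
  triangle (x y z : V) : d x z ≤ d x y + d y z
  exists_between (x y : V) (n : ℕ) (hn : n ≤ d x y) : ∃ w ∈ metricInterval d x y, d x w = n
  dist_le (x y : V) : G.dist x y ≤ d x y
  le_mul_dist (x y : V) : d x y ≤ K * G.dist x y
  thin (x y z w : V) (hw : w ∈ metricInterval d x z) :
    ∃ u ∈ metricInterval d x y ∪ metricInterval d y z, G.dist w u ≤ h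

namespace IsThinDirectedDist

open SimpleGraph (Walk)

variable {V : Type*} {G : SimpleGraph V} {d : V → V → ℕ} {K h : ℕ} {u v w x y z : V}

theorem self_eq_zero (H : IsThinDirectedDist G d K h) (x : V) : d x x = 0 := by
  simpa using H.le_mul_dist x x

theorem left_mem_metricInterval (H : IsThinDirectedDist G d K h) (x y : V) :
    x ∈ metricInterval d x y := by
  simp [metricInterval, H.self_eq_zero]

theorem right_mem_metricInterval (H : IsThinDirectedDist G d K h) (x y : V) :
    y ∈ metricInterval d x y := by
  simp [metricInterval, H.self_eq_zero]

protected theorem dist_triangle (H : IsThinDirectedDist G d K h) (x y z : V) :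
    G.dist x z ≤ G.dist x y + G.dist y z :=
  H.connected.dist_triangle

protected theorem flip (H : IsThinDirectedDist G d K h) : IsThinDirectedDist G (flip d) K h where
  connected := H.connected
  triangle x y z := (H.triangle z y x).trans_eq (add_comm _ _)
  exists_between x y n hn := by
    obtain ⟨w, hw, hyw⟩ := H.exists_between y x (d y x - n) (Nat.sub_le _ _)
    change d y w + d w x = d y x at hw
    change n ≤ d y x at hn
    refine ⟨w, (add_comm _ _).trans hw, ?_⟩
    change d w x = n
    lia
  dist_le x y := SimpleGraph.dist_comm.trans_le (H.dist_le y x)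
  le_mul_dist x y := (H.le_mul_dist y x).trans_eq (by rw [SimpleGraph.dist_comm])
  thin x y z w hw := by
    obtain ⟨u, hu | hu, hwu⟩ := H.thin z y x w ((add_comm _ _).trans hw)
    · exact ⟨u, .inr ((add_comm _ _).trans hu), hwu⟩
    · exact ⟨u, .inl ((add_comm _ _).trans hu), hwu⟩

/-- Subdividing the walk at its midpoint costs one application of thinness, hence a distance which
is logarithmic in the length of the walk. -/
theorem exists_mem_support_dist_le (H : IsThinDirectedDist G d K h) (k : ℕ) (c : G.Walk x y)
    (hc : c.length ≤ 2 ^ k) (hw : w ∈ metricInterval d x y) :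
    ∃ v ∈ c.support, G.dist w v ≤ h * k + K := by
  induction k generalizing x y w with
  | zero =>
    have hw' : d x w + d w y = d x y := hw
    have hxy : d x y ≤ K := calc
      d x y ≤ K * G.dist x y := H.le_mul_dist x y
      _ ≤ K * 1 := by gcongr; exact (SimpleGraph.dist_le c).trans hc
      _ = K := mul_one K
    have := H.dist_le x w
    exact ⟨x, c.start_mem_support, by rw [SimpleGraph.dist_comm]; lia⟩
  | succ k ih =>
    obtain ⟨u, hu | hu, hwu⟩ := H.thin x (c.getVert (2 ^ k)) y w hw
    · obtain ⟨v, hv, huv⟩ := ih (c.take (2 ^ k)) (by rw [Walk.take_length]; lia) hu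
      have := H.dist_triangle w u v
      exact ⟨v, (c.isSubwalk_take _).support_subset hv, by lia⟩
    · obtain ⟨v, hv, huv⟩ := ih (c.drop (2 ^ k)) (by rw [Walk.drop_length]; lia) hu
      have := H.dist_triangle w u v
      exact ⟨v, (c.isSubwalk_drop _).support_subset hv, by lia⟩

/-- The sides from `y` to `u` and from `v` to `z` are too far from `w` to be close to it. -/
theorem exists_mem_support_dist_le_of_quadrilateral (H : IsThinDirectedDist G d K h) {k : ℕ}
    (c : G.Walk u v) (hc : c.length ≤ 2 ^ k) (hw : w ∈ metricInterval d y z)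
    (hyu : d y u + 2 * h < G.dist y w) (hvz : d v z + 2 * h < G.dist w z) :
    ∃ t ∈ c.support, G.dist w t ≤ 2 * h + K + h * k := by
  obtain ⟨s, hs | hs, hws⟩ := H.thin y v z w hw
  · obtain ⟨t, ht | ht, hst⟩ := H.thin y u v s hs
    · have ht' : d y t + d t u = d y u := ht
      have := H.dist_le y t
      have := H.dist_triangle w s t
      have hytw := H.dist_triangle y t w
      rw [SimpleGraph.dist_comm (u := t)] at hytw
      lia
    · obtain ⟨a, ha, hta⟩ := H.exists_mem_support_dist_le k c hc ht
      have := H.dist_triangle w s a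
      have := H.dist_triangle s t a
      exact ⟨a, ha, by lia⟩
  · have hs' : d v s + d s z = d v z := hs
    have := H.dist_le s z
    have := H.dist_triangle w s z
    lia

theorem exists_dist_le_and_add_le_dist (H : IsThinDirectedDist G d K h) {S : Set V} {D : ℕ}
    (hcover : ∀ w ∈ metricInterval d x y, ∃ t ∈ S, G.dist w t ≤ D) (hx : x ∈ S)
    (hw : w ∈ metricInterval d x y) (hfar : ∀ t ∈ S, D ≤ G.dist w t) :
    ∃ a ∈ metricInterval d x w, ∃ u ∈ S, d a w ≤ K * ((K + 1) * D) ∧ G.dist a u ≤ D ∧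
      d a u + D ≤ G.dist a w := by
  rcases le_or_gt (d x w) (K * ((K + 1) * D)) with hle | hlt
  · refine ⟨x, H.left_mem_metricInterval x w, x, hx, hle, by simp, ?_⟩
    rw [H.self_eq_zero, zero_add, SimpleGraph.dist_comm]
    exact hfar x hx
  · obtain ⟨a, ha, hxa⟩ := H.exists_between x w (d x w - K * ((K + 1) * D)) (Nat.sub_le _ _)
    have haw : d a w = K * ((K + 1) * D) := by
      have : d x a + d a w = d x w := ha
      lia
    obtain ⟨u, hu, hau⟩ := hcover a (metricInterval_subset_of_mem_left H.triangle hw ha)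
    refine ⟨a, ha, u, hu, haw.le, hau, ?_⟩
    have hK : 0 < K := Nat.pos_of_mul_pos_right (hlt.trans_le (H.le_mul_dist x w) |>.pos)
    calc d a u + D ≤ K * G.dist a u + D := by gcongr; exact H.le_mul_dist a u
      _ ≤ K * D + D := by gcongr
      _ = (K + 1) * D := by ring
      _ ≤ G.dist a w := Nat.le_of_mul_le_mul_left (haw ▸ H.le_mul_dist a w) hK

/-- Let `D` be the largest distance to `g` of a point of the interval, attained at `w`. Leaving the
interval at points `a` and `b` around `w` for points `u` and `v` of `g` yields a quadrilateral whose
side from `u` to `v` along `g` has length `O(D)`, and the side from `a` to `b` is logarithmically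
close to it at `w`. -/
theorem le_add_mul_clog_of_covered (H : IsThinDirectedDist G d K h) {g : G.Walk x y}
    (hg : g.length = G.dist x y) {D : ℕ}
    (hcover : ∀ w ∈ metricInterval d x y, ∃ t ∈ g.support, G.dist w t ≤ D)
    (hw : w ∈ metricInterval d x y) (hfar : ∀ t ∈ g.support, D ≤ G.dist w t) :
    D ≤ 2 * h + K + h * Nat.clog 2 ((2 * (K * (K + 1)) + 2) * D) := by
  rcases le_or_gt D (2 * h) with hle | hlt
  · lia
  obtain ⟨a, ha, u, hu, haw, hau, hua⟩ := H.exists_dist_le_and_add_le_dist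
    (S := {t | t ∈ g.support}) hcover g.start_mem_support hw hfar
  obtain ⟨b, hb, v, hv, hwb, hbv, hvb⟩ := H.flip.exists_dist_le_and_add_le_dist
    (S := {t | t ∈ g.support}) (fun w hw ↦ hcover w ((add_comm _ _).trans hw)) g.end_mem_support
    ((add_comm _ _).trans hw) hfar
  change d v b + D ≤ G.dist b w at hvb
  change d w b ≤ _ at hwb
  obtain ⟨c, hc, hcg⟩ := exists_walk_length_eq_dist_of_mem_support hg hu hv
  have hlen : c.length ≤ (2 * (K * (K + 1)) + 2) * D := calc
    c.length = G.dist u v := hc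
    _ ≤ G.dist u a + G.dist a w + G.dist w b + G.dist b v := by
      have := H.dist_triangle u a v
      have := H.dist_triangle a w v
      have := H.dist_triangle w b v
      lia
    _ ≤ D + K * ((K + 1) * D) + K * ((K + 1) * D) + D := by
      gcongr
      · rwa [SimpleGraph.dist_comm]
      · exact (H.dist_le a w).trans haw
      · exact (H.dist_le w b).trans hwb
    _ = _ := by ring
  have hwab : w ∈ metricInterval d a b := by
    have hb' : d w b + d b y = d w y := (add_comm _ _).trans hb
    have : d a w + d w y = d a y := mem_metricInterval_of_mem_of_mem H.triangle hw ha
    have := H.triangle a w b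
    have := H.triangle a b y
    change d a w + d w b = d a b
    lia
  obtain ⟨t, ht, hwt⟩ := H.exists_mem_support_dist_le_of_quadrilateral c
    (hlen.trans (Nat.le_pow_clog one_lt_two _)) hwab (by lia)
    (by rw [SimpleGraph.dist_comm (u := w)]; lia)
  exact (hfar t (hcg ht)).trans hwt

/-- The Morse lemma: by `le_add_mul_clog_of_covered`, the largest distance `D` from a point of the
interval to `g` is bounded by a logarithm of `D`. -/
theorem exists_bound_dist_geodesic (H : IsThinDirectedDist G d K h) :
    ∃ R, ∀ (x y : V) (g : G.Walk x y), g.length = G.dist x y →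
      ∀ w ∈ metricInterval d x y, ∃ t ∈ g.support, G.dist w t ≤ R := by
  classical
  obtain ⟨R, hR⟩ := exists_bound_of_le_add_mul_clog (2 * h + K) h (2 * (K * (K + 1)) + 2)
  refine ⟨R, fun x y g hg ↦ ?_⟩
  have hex : ∃ D, ∀ w ∈ metricInterval d x y, ∃ t ∈ g.support, G.dist w t ≤ D := by
    refine ⟨d x y, fun w hw ↦ ⟨x, g.start_mem_support, ?_⟩⟩
    have : d x w + d w y = d x y := hw
    have := H.dist_le x w
    rw [SimpleGraph.dist_comm]
    lia
  obtain ⟨w, hw, hfar⟩ : ∃ w ∈ metricInterval d x y, ∀ t ∈ g.support,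
      Nat.find hex ≤ G.dist w t := by
    rcases (Nat.find hex).eq_zero_or_pos with hzero | hpos
    · exact ⟨x, H.left_mem_metricInterval x y, fun t _ ↦ by lia⟩
    · have := Nat.find_min hex (Nat.sub_one_lt_of_lt hpos)
      push Not at this
      exact this.imp fun w hw ↦ ⟨hw.1, fun t ht ↦ by have := hw.2 t ht; lia⟩
  have hbound := hR _ (H.le_add_mul_clog_of_covered hg (Nat.find_spec hex) hw hfar)
  exact fun w hw ↦ (Nat.find_spec hex w hw).imp fun t ht ↦ ⟨ht.1, ht.2.trans hbound⟩

theorem exists_mem_notMem_of_mem_of_notMem (H : IsThinDirectedDist G d K h) {P : Set V}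
    (hx : x ∈ P) (hy : y ∉ P) :
    ∃ v ∈ metricInterval d x y, ∃ w ∈ metricInterval d x y, d v w = 1 ∧ v ∈ P ∧ w ∉ P := by
  induction hn : d x y generalizing x with
  | zero =>
    have hxy : x = y := H.connected.dist_eq_zero_iff.1 (Nat.le_zero.1 (hn ▸ H.dist_le x y))
    exact absurd (hxy ▸ hx) hy
  | succ n ih =>
    obtain ⟨z, hz, hxz⟩ := H.exists_between x y 1 (by lia)
    by_cases hzP : z ∈ P
    · have hzy : d z y = n := by
        have : d x z + d z y = d x y := hz
        lia
      obtain ⟨v, hv, w, hw, hvw⟩ := ih hzP hzy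
      have hsub := metricInterval_subset_of_mem_right H.triangle hz
      exact ⟨v, hsub hv, w, hsub hw, hvw⟩
    · exact ⟨x, H.left_mem_metricInterval x y, z, hz, hxz, hx, hzP⟩

/-- Walking along a directed geodesic, the nearby point of `g` jumps at some step from the part of
`g` before `s` to the part after `s`, and the length of this jump is bounded. -/
theorem exists_mem_metricInterval_dist_le (H : IsThinDirectedDist G d K h) {g : G.Walk x y}
    (hg : g.length = G.dist x y) {D : ℕ}
    (hcover : ∀ w ∈ metricInterval d x y, ∃ t ∈ g.support, G.dist w t ≤ D)
    {s : V} (hs : s ∈ g.support) : ∃ w ∈ metricInterval d x y, G.dist s w ≤ 3 * D + 1 := by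
  classical
  rw [← g.take_spec hs] at hg
  have hsplit {a b : V} (ha : a ∈ (g.takeUntil s hs).support)
      (hb : b ∈ (g.dropUntil s hs).support) : G.dist a s + G.dist s b = G.dist a b :=
    dist_add_dist_of_mem_support_append H.connected hg ha hb
  by_cases hy : ∃ a ∈ (g.takeUntil s hs).support, G.dist y a ≤ D
  · obtain ⟨a, ha, hya⟩ := hy
    have := hsplit ha (g.dropUntil s hs).end_mem_support
    rw [SimpleGraph.dist_comm (u := y)] at hya
    exact ⟨y, H.right_mem_metricInterval x y, by lia⟩
  obtain ⟨v, hv, w, hw, hvw, ⟨a, ha, hva⟩, hwa⟩ := H.exists_mem_notMem_of_mem_of_notMem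
    (P := {w | ∃ a ∈ (g.takeUntil s hs).support, G.dist w a ≤ D})
    ⟨x, (g.takeUntil s hs).start_mem_support, SimpleGraph.dist_self.trans_le D.zero_le⟩ hy
  obtain ⟨b, hb, hwb⟩ := hcover w hw
  rw [← g.take_spec hs, Walk.mem_support_append_iff] at hb
  have hab := hsplit ha (hb.resolve_left fun hb ↦ hwa ⟨b, hb, hwb⟩)
  refine ⟨v, hv, ?_⟩
  have := H.dist_le v w
  have := H.dist_triangle a v b
  have := H.dist_triangle v w b
  have hsav := H.dist_triangle s a v
  rw [SimpleGraph.dist_comm (u := v) (v := a)] at hva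
  rw [SimpleGraph.dist_comm (u := s) (v := a)] at hsav
  lia

theorem exists_isSlimHyperbolic (H : IsThinDirectedDist G d K h) :
    ∃ δ : ℝ≥0, G.IsSlimHyperbolic δ := by
  obtain ⟨R, hR⟩ := H.exists_bound_dist_geodesic
  refine ⟨(3 * R + 1 + h + R : ℕ), fun x y z p q r hp hq hr u hu ↦ ?_⟩
  suffices ∃ v, (v ∈ q.support ∨ v ∈ r.support) ∧ G.dist u v ≤ 3 * R + 1 + h + R from
    this.imp fun v hv ↦ ⟨hv.1, by exact_mod_cast hv.2⟩
  obtain ⟨w, hw, huw⟩ := H.exists_mem_metricInterval_dist_le hp (hR x y p hp) hu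
  obtain ⟨s, hs, hws⟩ := H.thin x z y w hw
  obtain ⟨v, hv, hsv⟩ : ∃ v, (v ∈ q.support ∨ v ∈ r.support) ∧ G.dist s v ≤ R := by
    rcases hs with hs | hs
    · exact (hR x z r hr s hs).imp fun v hv ↦ ⟨.inr hv.1, hv.2⟩
    · have hq' : q.reverse.length = G.dist z y := by
        rw [Walk.length_reverse, hq, SimpleGraph.dist_comm]
      refine (hR z y q.reverse hq' s hs).imp fun v hv ↦ ⟨.inl ?_, hv.2⟩
      simpa only [Walk.support_reverse, List.mem_reverse] using hv.1
  have := H.dist_triangle u w v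
  have := H.dist_triangle w s v
  exact ⟨v, hv, by lia⟩

end IsThinDirectedDist

/-! ### Paths and distances in directed graphs -/

namespace DirectedGraph

open Digraph
open scoped InitialSeg

variable {V W : Type*} {X : Digraph V} {Y : Digraph W}

section EDist

theorem adj_castSucc_succ (p : X.Path) (i : Fin p.length) : X.Adj (p i.castSucc) (p i.succ) :=
  p.step i

theorem edist_le_length (p : X.Path) : X.edist p.head p.last ≤ p.length :=
  iInf₂_le p ⟨rfl, rfl⟩

theorem edist_head_apply_le (p : X.Path) (i : Fin (p.length + 1)) :
    X.edist p.head (p i) ≤ (i : ℕ) := by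
  have := edist_le_length (p.take i)
  rwa [RelSeries.head_take, RelSeries.last_take] at this

theorem edist_apply_last_le (p : X.Path) (i : Fin (p.length + 1)) :
    X.edist (p i) p.last ≤ (p.length - i : ℕ) := by
  have := edist_le_length (p.drop i)
  rwa [RelSeries.head_drop, RelSeries.last_drop] at this

theorem exists_path_length_eq_edist {x y : V} (hxy : X.edist x y ≠ ⊤) :
    ∃ p : X.Path, p.head = x ∧ p.last = y ∧ (p.length : ℕ∞) = X.edist x y := by
  obtain ⟨p, ⟨rfl, rfl⟩, hp⟩ : ∃ p : X.Path, ∃ _ : p.head = x ∧ p.last = y,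
      (p.length : ℕ∞) < X.edist x y + 1 := by
    have hlt : X.edist x y < X.edist x y + 1 := (ENat.lt_add_one_iff hxy).2 le_rfl
    obtain ⟨p, hp⟩ := iInf_lt_iff.1 hlt
    exact ⟨p, iInf_lt_iff.1 hp⟩
  exact ⟨p, rfl, rfl, le_antisymm ((ENat.lt_add_one_iff hxy).1 hp) (edist_le_length p)⟩

theorem edist_self (x : V) : X.edist x x = 0 :=
  le_antisymm (edist_le_length (RelSeries.singleton X.edgeRel x)) zero_le

theorem edist_triangle (x y z : V) : X.edist x z ≤ X.edist x y + X.edist y z := by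
  by_cases hxy : X.edist x y = ⊤
  · simp [hxy]
  by_cases hyz : X.edist y z = ⊤
  · simp [hyz]
  obtain ⟨p, rfl, rfl, hp⟩ := exists_path_length_eq_edist hxy
  obtain ⟨q, hpq, rfl, hq⟩ := exists_path_length_eq_edist hyz
  have := edist_le_length (p.smash q hpq.symm)
  rw [RelSeries.head_smash, RelSeries.last_smash] at this
  rw [← hp, ← hq]
  exact_mod_cast this

theorem edist_le_one_of_adj {x y : V} (h : X.Adj x y) : X.edist x y ≤ 1 := by
  let p : X.Path := ⟨1, ![x, y], fun i ↦ by obtain rfl := Subsingleton.elim i 0; exact h⟩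
  exact (edist_le_length p).trans_eq Nat.cast_one

theorem edist_map_le {f : V → W} (hf : ∀ x y, X.Adj x y → Y.Adj (f x) (f y)) (x y : V) :
    Y.edist (f x) (f y) ≤ X.edist x y := by
  refine le_iInf₂ fun p hp ↦ ?_
  obtain ⟨rfl, rfl⟩ := hp
  exact edist_le_length (X := Y) (p.map ⟨f, hf _ _⟩)

end EDist

section InitialSeg

theorem exists_path_lift (φ : X.Adj ≼i Y.Adj) (p : Y.Path) (y : V) (hy : φ y = p.last) :
    ∃ q : X.Path, q.length = p.length ∧ φ q.head = p.head ∧ q.last = y := by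
  have hrange (i : Fin (p.length + 1)) : ∃ x, φ x = p i := by
    induction i using Fin.reverseInduction with
    | last => exact ⟨y, hy⟩
    | cast i ih =>
      obtain ⟨x, hx⟩ := ih
      exact φ.mem_range_of_rel (hx ▸ p.step i)
  choose f hf using hrange
  have hstep (i : Fin p.length) : X.Adj (f i.castSucc) (f i.succ) := by
    rw [← φ.map_rel_iff]
    simpa only [hf] using adj_castSucc_succ p i
  exact ⟨⟨p.length, f, hstep⟩, rfl, hf 0, φ.injective ((hf _).trans hy.symm)⟩

theorem edist_initialSeg (φ : X.Adj ≼i Y.Adj) (x y : V) :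
    Y.edist (φ x) (φ y) = X.edist x y := by
  refine le_antisymm (edist_map_le (fun _ _ ↦ φ.map_rel_iff.2) x y) (le_iInf₂ fun p hp ↦ ?_)
  obtain ⟨q, hlen, hhead, rfl⟩ := exists_path_lift φ p y hp.2.symm
  obtain rfl := φ.injective (hhead.trans hp.1)
  exact hlen ▸ edist_le_length q

theorem support_map (f : X.edgeRel.Hom Y.edgeRel) (p : X.Path) :
    Path.support (X := Y) (p.map f) = f '' Path.support p :=
  Set.range_comp f p

theorem mem_outNhd_of_initialSeg (φ : X.Adj ≼i Y.Adj) {δ : ℝ≥0} {S : Set V} {x : V}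
    (hx : φ x ∈ Y.outNhd δ (φ '' S)) : x ∈ X.outNhd δ S := by
  simpa [outNhd, outBall, edist_initialSeg] using hx

theorem mem_inNhd_of_initialSeg (φ : X.Adj ≼i Y.Adj) {δ : ℝ≥0} {S : Set V} {x : V}
    (hx : φ x ∈ Y.inNhd δ (φ '' S)) : x ∈ X.inNhd δ S := by
  simpa [inNhd, inBall, edist_initialSeg] using hx

theorem stronglyHyperbolic_of_initialSeg (φ : X.Adj ≼i Y.Adj) {δ : ℝ≥0}
    (hY : Y.StronglyHyperbolic δ) : X.StronglyHyperbolic δ := by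
  let f : X.edgeRel.Hom Y.edgeRel := ⟨φ, φ.map_rel_iff.2⟩
  have hgeo {p : X.Path} (hp : Path.IsGeodesic p) : Path.IsGeodesic (X := Y) (p.map f) :=
    Eq.trans hp (edist_initialSeg φ _ _).symm
  have hpull {p q r : X.Path} (h : Path.support (X := Y) (r.map f) ⊆
      Y.outNhd δ (Path.support (X := Y) (p.map f)) ∪
        Y.inNhd δ (Path.support (X := Y) (q.map f))) :
      Path.support r ⊆ X.outNhd δ (Path.support p) ∪ X.inNhd δ (Path.support q) := by
    intro x hx
    simp only [support_map] at h
    exact (h ⟨x, hx, rfl⟩).imp (mem_outNhd_of_initialSeg φ) (mem_inNhd_of_initialSeg φ)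
  intro p q r hpqr
  obtain ⟨hr, hp, hq⟩ := hY (p.map f) (q.map f) (r.map f)
    ⟨hgeo hpqr.geodesic_left, hgeo hpqr.geodesic_right, hgeo hpqr.geodesic_base,
      congrArg φ hpqr.composable, congrArg φ hpqr.start_eq, congrArg φ hpqr.end_eq⟩
  exact ⟨hpull hr, hpull hp, hpull hq⟩

end InitialSeg

section DirectedDist

/-- The directed distance as a natural number, with junk value `0` where there is no path. -/
noncomputable def directedDist (X : Digraph V) (x y : V) : ℕ := (X.edist x y).toNat

theorem coe_directedDist (hfin : ∀ x y, X.edist x y ≠ ⊤) (x y : V) :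
    (directedDist X x y : ℕ∞) = X.edist x y :=
  ENat.natCast_toNat (hfin x y)

theorem directedDist_triangle (hfin : ∀ x y, X.edist x y ≠ ⊤) (x y z : V) :
    directedDist X x z ≤ directedDist X x y + directedDist X y z := by
  have := edist_triangle (X := X) x y z
  simp only [← coe_directedDist hfin] at this
  exact_mod_cast this

theorem exists_path_length_eq_directedDist (hfin : ∀ x y, X.edist x y ≠ ⊤) (x y : V) :
    ∃ p : X.Path, p.head = x ∧ p.last = y ∧ p.length = directedDist X x y := by
  obtain ⟨p, hx, hy, hp⟩ := exists_path_length_eq_edist (hfin x y)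
  rw [← coe_directedDist hfin] at hp
  exact ⟨p, hx, hy, by exact_mod_cast hp⟩

theorem isGeodesic_iff_length_eq_directedDist (hfin : ∀ x y, X.edist x y ≠ ⊤) {p : X.Path} :
    Path.IsGeodesic p ↔ p.length = directedDist X p.head p.last := by
  rw [Path.IsGeodesic, ← coe_directedDist hfin, Nat.cast_inj]

theorem directedDist_le_of_edist_le {x y : V} {n : ℕ} (h : X.edist x y ≤ n) :
    directedDist X x y ≤ n :=
  ENat.toNat_le_of_le_natCast h

theorem apply_mem_metricInterval (hfin : ∀ x y, X.edist x y ≠ ⊤) {p : X.Path}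
    (hp : Path.IsGeodesic p) (i : Fin (p.length + 1)) :
    p i ∈ metricInterval (directedDist X) p.head p.last := by
  rw [isGeodesic_iff_length_eq_directedDist hfin] at hp
  have := directedDist_le_of_edist_le (edist_head_apply_le p i)
  have := directedDist_le_of_edist_le (edist_apply_last_le p i)
  have := directedDist_triangle hfin p.head (p i) p.last
  have := i.is_le
  change directedDist X p.head (p i) + directedDist X (p i) p.last = directedDist X p.head p.last
  lia

theorem directedDist_head_apply (hfin : ∀ x y, X.edist x y ≠ ⊤) {p : X.Path}
    (hp : Path.IsGeodesic p) (i : Fin (p.length + 1)) : directedDist X p.head (p i) = i := by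
  have hi : directedDist X p.head (p i) + directedDist X (p i) p.last =
      directedDist X p.head p.last := apply_mem_metricInterval hfin hp i
  rw [isGeodesic_iff_length_eq_directedDist hfin] at hp
  have := directedDist_le_of_edist_le (edist_head_apply_le p i)
  have := directedDist_le_of_edist_le (edist_apply_last_le p i)
  have := i.is_le
  lia

theorem exists_isGeodesic_mem_support (hfin : ∀ x y, X.edist x y ≠ ⊤) {w x y : V}
    (hw : w ∈ metricInterval (directedDist X) x y) :
    ∃ p : X.Path, Path.IsGeodesic p ∧ p.head = x ∧ p.last = y ∧ w ∈ Path.support p := by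
  obtain ⟨p, rfl, rfl, hp⟩ := exists_path_length_eq_directedDist hfin x w
  obtain ⟨q, hpq, rfl, hq⟩ := exists_path_length_eq_directedDist hfin p.last y
  have hlen : p.length + q.length = directedDist X p.head q.last := by rwa [hp, hq]
  refine ⟨p.smash q hpq.symm, ?_, RelSeries.head_smash _, RelSeries.last_smash _,
    ⟨Fin.castLE (by simp) (Fin.last p.length), RelSeries.smash_castLE hpq.symm _⟩⟩
  rwa [isGeodesic_iff_length_eq_directedDist hfin, RelSeries.head_smash, RelSeries.last_smash]

theorem directedDist_le_floor (hfin : ∀ x y, X.edist x y ≠ ⊤) {δ : ℝ≥0} {x y : V}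
    (h : (X.edist x y : ℝ≥0∞) ≤ δ) : directedDist X x y ≤ ⌊δ⌋₊ := by
  rw [← coe_directedDist hfin, ENat.toENNReal_coe, ← ENNReal.coe_natCast] at h
  exact Nat.le_floor (ENNReal.coe_le_coe.1 h)

theorem exists_directedDist_le_of_stronglyHyperbolic (hfin : ∀ x y, X.edist x y ≠ ⊤) {δ : ℝ≥0}
    (hX : X.StronglyHyperbolic δ) {w x z : V} (y : V)
    (hw : w ∈ metricInterval (directedDist X) x z) :
    (∃ u ∈ metricInterval (directedDist X) x y, directedDist X u w ≤ ⌊δ⌋₊) ∨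
      ∃ u ∈ metricInterval (directedDist X) y z, directedDist X w u ≤ ⌊δ⌋₊ := by
  obtain ⟨r, hr, hrx, hrz, hwr⟩ := exists_isGeodesic_mem_support hfin hw
  obtain ⟨p, rfl, rfl, hp⟩ := exists_path_length_eq_directedDist hfin x y
  obtain ⟨q, hpq, rfl, hq⟩ := exists_path_length_eq_directedDist hfin p.last z
  rw [← hpq] at hq ⊢
  rw [← isGeodesic_iff_length_eq_directedDist hfin] at hp hq
  obtain hout | hin := (hX p q r ⟨hp, hq, hr, hpq.symm, hrx.symm, hrz.symm⟩).1 hwr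
  · simp only [outNhd, Set.mem_iUnion] at hout
    obtain ⟨_, ⟨i, rfl⟩, hi⟩ := hout
    exact .inl ⟨_, hpq ▸ apply_mem_metricInterval hfin hp i,
      directedDist_le_floor hfin hi⟩
  · simp only [inNhd, Set.mem_iUnion] at hin
    obtain ⟨_, ⟨i, rfl⟩, hi⟩ := hin
    exact .inr ⟨_, apply_mem_metricInterval hfin hq i,
      directedDist_le_floor hfin hi⟩

end DirectedDist

section UnderlyingGraph

theorem exists_walk_length_le (p : X.Path) :
    ∃ w : X.toSimpleGraphInclusive.Walk p.head p.last, w.length ≤ p.length := by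
  suffices ∀ i : Fin (p.length + 1),
      ∃ w : X.toSimpleGraphInclusive.Walk p.head (p i), w.length ≤ i from this (Fin.last _)
  intro i
  induction i using Fin.induction with
  | zero => exact ⟨.nil, le_rfl⟩
  | succ i ih =>
    obtain ⟨w, hw⟩ := ih
    rw [Fin.val_castSucc] at hw
    by_cases heq : p i.castSucc = p i.succ
    · exact ⟨w.copy rfl heq, by rw [SimpleGraph.Walk.length_copy, Fin.val_succ]; lia⟩
    · have hadj : X.toSimpleGraphInclusive.Adj (p i.castSucc) (p i.succ) :=
        ⟨heq, .inl (adj_castSucc_succ p i)⟩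
      exact ⟨w.concat hadj, by rw [SimpleGraph.Walk.length_concat, Fin.val_succ]; lia⟩

theorem edist_le_mul_length {K : ℕ}
    (hK : ∀ x y, X.toSimpleGraphInclusive.Adj x y → X.edist x y ≤ K) {x y : V}
    (w : X.toSimpleGraphInclusive.Walk x y) : X.edist x y ≤ (K * w.length : ℕ) := by
  induction w with
  | nil => simp [edist_self]
  | @cons u v y h w ih => calc
      X.edist u y ≤ X.edist u v + X.edist v y := edist_triangle u v y
      _ ≤ K + (K * w.length : ℕ) := add_le_add (hK u v h) ih
      _ = (K * (w.length + 1) : ℕ) := by push_cast; ring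

theorem isThinDirectedDist [Nonempty V] {δ : ℝ≥0} {K : ℕ} (hX : X.StronglyHyperbolic δ)
    (hfin : ∀ x y, X.edist x y ≠ ⊤)
    (hK : ∀ x y, X.toSimpleGraphInclusive.Adj x y → X.edist x y ≤ K) :
    IsThinDirectedDist X.toSimpleGraphInclusive (directedDist X) K ⌊δ⌋₊ := by
  have hwalk (x y : V) :
      ∃ w : X.toSimpleGraphInclusive.Walk x y, w.length ≤ directedDist X x y := by
    obtain ⟨p, rfl, rfl, hp⟩ := exists_path_length_eq_directedDist hfin x y
    exact hp ▸ exists_walk_length_le p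
  have hdist (x y : V) : X.toSimpleGraphInclusive.dist x y ≤ directedDist X x y := by
    obtain ⟨w, hw⟩ := hwalk x y
    exact (SimpleGraph.dist_le w).trans hw
  have hconn : X.toSimpleGraphInclusive.Connected :=
    ⟨fun x y ↦ (hwalk x y).elim fun w _ ↦ w.reachable⟩
  refine ⟨hconn, directedDist_triangle hfin, fun x y n hn ↦ ?_, hdist, fun x y ↦ ?_,
    fun x y z w hw ↦ ?_⟩
  · obtain ⟨p, rfl, rfl, hp⟩ := exists_path_length_eq_directedDist hfin x y
    have hgeo := (isGeodesic_iff_length_eq_directedDist hfin).2 hp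
    exact ⟨_, apply_mem_metricInterval hfin hgeo ⟨n, by lia⟩, directedDist_head_apply hfin hgeo _⟩
  · obtain ⟨w, hw⟩ := hconn.exists_walk_length_eq_dist x y
    have := edist_le_mul_length hK w
    rw [hw, ← coe_directedDist hfin] at this
    exact_mod_cast this
  · obtain ⟨u, hu, huw⟩ | ⟨u, hu, hwu⟩ := exists_directedDist_le_of_stronglyHyperbolic hfin hX y hw
    · exact ⟨u, .inl hu, SimpleGraph.dist_comm.trans_le ((hdist u w).trans huw)⟩
    · exact ⟨u, .inr hu, (hdist w u).trans hwu⟩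

end UnderlyingGraph

/-! ### Cayley graphs -/

section Cayley

theorem toSimpleGraphInclusive_rightCayley {M : Type*} [Monoid M] (S : Set M) :
    (rightCayley S).toSimpleGraphInclusive = SimpleGraph.mulCayley S :=
  rfl

theorem rightCayley_edist_mul_le {M : Type*} [Monoid M] (S : Set M) (g x y : M) :
    (rightCayley S).edist (g * x) (g * y) ≤ (rightCayley S).edist x y := by
  refine edist_map_le (Y := rightCayley S) (f := (g * ·)) ?_ x y
  rintro a b ⟨s, hs, rfl⟩
  exact ⟨s, hs, mul_assoc g a s⟩

theorem rightCayley_edist_mul_ne_top {M : Type*} [Monoid M] {S : Set M}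
    (hS : Submonoid.closure S = ⊤) (x m : M) : (rightCayley S).edist x (x * m) ≠ ⊤ := by
  have hm : m ∈ Submonoid.closure S := hS ▸ Submonoid.mem_top m
  induction hm using Submonoid.closure_induction generalizing x with
  | mem s hs =>
    have hadj : (rightCayley S).Adj x (x * s) := ⟨s, hs, rfl⟩
    exact ne_top_of_le_ne_top ENat.one_ne_top (edist_le_one_of_adj hadj)
  | one => simp [edist_self]
  | mul a b _ _ ha hb =>
    refine ne_top_of_le_ne_top (WithTop.add_ne_top.2 ⟨ha x, hb (x * a)⟩) ?_
    rw [← mul_assoc]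
    exact edist_triangle x (x * a) (x * a * b)

theorem rightCayley_edist_ne_top {G : Type*} [Group G] {S : Set G}
    (hS : Submonoid.closure S = ⊤) (x y : G) : (rightCayley S).edist x y ≠ ⊤ := by
  simpa only [mul_inv_cancel_left] using rightCayley_edist_mul_ne_top hS x (x⁻¹ * y)

theorem exists_rightCayley_edist_le_of_adj {G : Type*} [Group G] {S : Set G} (hfin : S.Finite)
    (hS : Submonoid.closure S = ⊤) : ∃ K : ℕ, ∀ x y,
      (rightCayley S).toSimpleGraphInclusive.Adj x y → (rightCayley S).edist x y ≤ K := by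
  obtain ⟨K, hK⟩ := (hfin.image fun s ↦ directedDist (rightCayley S) 1 s⁻¹).bddAbove
  refine ⟨max 1 K, fun x y hxy ↦ ?_⟩
  obtain ⟨-, hadj | ⟨s, hs, rfl⟩⟩ := hxy
  · exact (edist_le_one_of_adj hadj).trans (by exact_mod_cast le_max_left 1 K)
  · calc (rightCayley S).edist (y * s) y
      _ = (rightCayley S).edist (y * s * 1) (y * s * s⁻¹) := by
        rw [mul_one, mul_inv_cancel_right]
      _ ≤ (rightCayley S).edist 1 s⁻¹ := rightCayley_edist_mul_le S _ _ _
      _ = directedDist (rightCayley S) 1 s⁻¹ :=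
        (coe_directedDist (rightCayley_edist_ne_top hS) _ _).symm
      _ ≤ max 1 K := by exact_mod_cast (hK ⟨s, hs, rfl⟩).trans (le_max_right 1 K)

/-- The inclusion of the units as an initial segment for the edge relations of the right Cayley
graphs: every edge into a unit starts at a unit and is labelled by a unit. -/
def unitsInitialSeg {M : Type*} [Monoid M] [IsDedekindFiniteMonoid M] (S : Set M) :
    (rightCayley (Units.val ⁻¹' S : Set Mˣ)).Adj ≼i (rightCayley S).Adj where
  toFun := Units.val
  inj' := Units.val_injective
  map_rel_iff' {u v} := by
    refine ⟨fun ⟨s, hs, hsv⟩ ↦ ⟨u⁻¹ * v, ?_, mul_inv_cancel_left u v⟩,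
      fun ⟨s, hs, hsv⟩ ↦ ⟨s, hs, congrArg Units.val hsv⟩⟩
    have hs' : ((u⁻¹ * v : Mˣ) : M) = s := by
      rw [Units.val_mul, Units.inv_mul_eq_iff_eq_mul]
      exact hsv.symm
    rwa [Set.mem_preimage, hs']
  mem_range_of_rel' := by
    rintro u m ⟨s, -, hsu : m * s = u⟩
    exact isUnit_of_mul_isUnit_left (hsu ▸ u.isUnit)

end Cayley

end DirectedGraph

theorem closure_units_preimage_eq_top {M : Type*} [Monoid M] [IsDedekindFiniteMonoid M] {S : Set M}
    (hS : Submonoid.closure S = ⊤) :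
    Submonoid.closure (Units.val ⁻¹' S : Set Mˣ) = ⊤ := by
  refine eq_top_iff.2 fun u _ ↦ ?_
  have hu : (u : M) ∈ Submonoid.closure S := hS ▸ Submonoid.mem_top _
  generalize hm : (u : M) = m at hu
  induction hu using Submonoid.closure_induction generalizing u with
  | mem s hs => exact Submonoid.subset_closure (by rwa [Set.mem_preimage, hm])
  | one =>
    rw [Units.val_eq_one.1 hm]
    exact one_mem _
  | mul a b _ _ ha hb =>
    have hab : IsUnit (a * b) := hm ▸ u.isUnit
    obtain ⟨v, rfl⟩ := isUnit_of_mul_isUnit_left hab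
    obtain ⟨w, rfl⟩ := isUnit_of_mul_isUnit_right hab
    rw [← Units.val_mul, Units.val_inj] at hm
    rw [hm]
    exact mul_mem (ha v trivial rfl) (hb w trivial rfl)

namespace IsStronglyHyperbolicMonoid

open Digraph DirectedGraph

theorem isHyperbolicGroup {G : Type*} [Group G] (hG : IsStronglyHyperbolicMonoid G) :
    IsHyperbolicGroup G := by
  obtain ⟨S, hfin, hS, δ, hδ⟩ := hG
  obtain ⟨K, hK⟩ := exists_rightCayley_edist_le_of_adj hfin hS
  refine ⟨S, hfin, Subgroup.closure_eq_top_of_mclosure_eq_top hS, ?_⟩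
  rw [← toSimpleGraphInclusive_rightCayley]
  exact (isThinDirectedDist hδ (rightCayley_edist_ne_top hS) hK).exists_isSlimHyperbolic

theorem units {M : Type*} [Monoid M] [IsDedekindFiniteMonoid M]
    (hM : IsStronglyHyperbolicMonoid M) : IsStronglyHyperbolicMonoid Mˣ := by
  obtain ⟨S, hfin, hS, δ, hδ⟩ := hM
  exact ⟨Units.val ⁻¹' S, hfin.preimage Units.val_injective.injOn,
    closure_units_preimage_eq_top hS, δ, stronglyHyperbolic_of_initialSeg (unitsInitialSeg S) hδ⟩

end IsStronglyHyperbolicMonoid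

theorem mainTheorem10_general (M : Type*) [Monoid M] [IsDedekindFiniteMonoid M]
    (hM : IsStronglyHyperbolicMonoid M) : IsHyperbolicGroup Mˣ :=
  hM.units.isHyperbolicGroup

theorem mainTheorem10 (M : Type*) [Monoid M] [IsCancelMul M]
    (hM : IsStronglyHyperbolicMonoid M) : IsHyperbolicGroup Mˣ :=
  mainTheorem10_general M hM
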